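/- For nonzero integers $m,n$ let $B(m,n)=\langle a,b : a^{-1}b^{m}a=b^{n}\rangle$ be the Baumslag--Solitar group, and let $|\cdot|_a : B(m,n)\to\mathbb{Z}$ be the homomorphism with $|a|_a=1$ and $|b|_a=0$ (the exponent sum of $a$). For an endomorphism $\phi$ of a group $G$, two elements $x,y\in G$ are $\phi$-conjugate if $y=g\,x\,\phi(g)^{-1}$ for some $g\in G$; the Reidemeister number $R(\phi)$ is the number of $\phi$-conjugacy classes. Theorem. Let $m,n$ be integers with $|m|>1$, $|n|>1$ and $|m|\neq|n|$ (in particular, any $m,n$ with $1<m<|n|$). Then every injective endomorphism $\phi$ of $B(m,n)$ induces the identity on the quotient $B(m,n)/\ker|\cdot|_a\cong\mathbb{Z}$, that is, $|\phi(g)|_a=|g|_a$ for all $g\in B(m,n)$, and $R(\phi)=\infty$. -/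

import Mathlib

/-- The two generators of a Baumslag-Solitar group. -/
inductive BSGen : Type
  | a : BSGen
  | b : BSGen

/-- The relator `a⁻¹ bᵐ a (bⁿ)⁻¹` in the free group on `a, b`. -/
def bsRelator (m n : ℤ) : FreeGroup BSGen :=
  (FreeGroup.of BSGen.a)⁻¹ * FreeGroup.of BSGen.b ^ m * FreeGroup.of BSGen.a *
    (FreeGroup.of BSGen.b ^ n)⁻¹

/-- The Baumslag-Solitar group `B(m,n) = ⟨a, b : a⁻¹ bᵐ a = bⁿ⟩`. -/
abbrev BaumslagSolitar (m n : ℤ) : Type :=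
  PresentedGroup ({bsRelator m n} : Set (FreeGroup BSGen))

/-- The values on the generators of the exponent sum in `a`: `a ↦ 1`, `b ↦ 0`. -/
def bsGenExp : BSGen → Multiplicative ℤ
  | BSGen.a => Multiplicative.ofAdd 1
  | BSGen.b => 1

theorem bsGenExp_relator (m n : ℤ) :
    ∀ r ∈ ({bsRelator m n} : Set (FreeGroup BSGen)), FreeGroup.lift bsGenExp r = 1 := by
  intro r hr
  rw [Set.mem_singleton_iff.mp hr]
  simp [bsRelator, bsGenExp]

/-- The homomorphism `B(m,n) → ℤ` sending a word to the sum of the exponents of `a` in it. -/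
def bsExpSum (m n : ℤ) : BaumslagSolitar m n →* Multiplicative ℤ :=
  PresentedGroup.toGroup (bsGenExp_relator m n)

/-- Twisted conjugacy: `x` and `y` are `φ`-conjugate if `y = g x φ(g)⁻¹` for some `g`. -/
def twistedConjSetoid {G : Type*} [Group G] (φ : G →* G) : Setoid G where
  r x y := ∃ g : G, y = g * x * (φ g)⁻¹
  iseqv :=
    { refl := fun x => ⟨1, by simp⟩
      symm := by
        rintro x y ⟨g, rfl⟩
        exact ⟨g⁻¹, by simp [mul_assoc]⟩
      trans := by
        rintro x y z ⟨g, rfl⟩ ⟨h, rfl⟩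
        exact ⟨h * g, by simp [mul_assoc]⟩ }

/-- The Reidemeister number of `φ`: the number of `φ`-conjugacy classes (`⊤` if infinite). -/
noncomputable def reidemeisterNumber {G : Type*} [Group G] (φ : G →* G) : ℕ∞ :=
  ENat.card (Quotient (twistedConjSetoid φ))

/-!
`B(m,n)` is the HNN extension of `⟨b⟩ ≅ ℤ` with stable letter `a`. In an HNN extension the powers of
a cyclically reduced word grow linearly in length, so an element whose powers `g ^ m`, `g ^ n` with
`|m| ≠ |n|` are conjugate must be conjugate into the base group. Applied to the image of the
relation `a b ^ n a⁻¹ = b ^ m` under an endomorphism `φ`, this shows that `φ b` is conjugate to some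
`b ^ k`. In the affine action on `ℚ` where `b` translates by `1` and `a` scales by `m / n`, an
element conjugating `b ^ (k * n)` to `b ^ (k * m)` with `k ≠ 0` must scale by `m / n`, hence has
exponent sum `1`. So `φ` preserves the exponent sum, which then separates the twisted conjugacy
classes of the powers of `a`.
-/


theorem le_of_semiconjBy_pow_of_subadditive {G : Type*} [Group G] {ℓ : G → ℕ}
    (hmul : ∀ x y, ℓ (x * y) ≤ ℓ x + ℓ y) {c w : G} (hpow : ∀ k, ℓ (w ^ k) = k * ℓ w)
    (hw : 0 < ℓ w) {M N : ℕ} (h : SemiconjBy c (w ^ M) (w ^ N)) : N ≤ M := by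
  have bound (k : ℕ) : N * k * ℓ w ≤ M * k * ℓ w + (ℓ c + ℓ c⁻¹) := by
    have hconj : c * w ^ (M * k) * c⁻¹ = w ^ (N * k) := by
      rw [pow_mul, pow_mul]
      exact mul_inv_eq_iff_eq_mul.2 (h.pow_right k).eq
    calc N * k * ℓ w = ℓ (c * w ^ (M * k) * c⁻¹) := by rw [hconj, hpow]
      _ ≤ ℓ c + ℓ (w ^ (M * k)) + ℓ c⁻¹ := (hmul _ _).trans (by gcongr; exact hmul _ _)
      _ = M * k * ℓ w + (ℓ c + ℓ c⁻¹) := by rw [hpow]; ring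
  by_contra! hlt
  have hlarge := bound (ℓ c + ℓ c⁻¹ + 1)
  have hgap : (M + 1) * (ℓ c + ℓ c⁻¹ + 1) * ℓ w ≤ N * (ℓ c + ℓ c⁻¹ + 1) * ℓ w := by
    gcongr
    exact hlt
  nlinarith

section HNN

open HNNExtension

variable {G : Type*} [Group G] {A B : Subgroup G}

variable (A B) in
/-- Consecutive syllables `t ^ u * g`, `t ^ v * h` of a word in an HNN extension do not cancel: it
is not the case that `v = -u` and `t ^ u * g * t ^ (-u)` lies in the base group. A word is reduced
if it is a chain for this relation, as in `HNNExtension.NormalWord.ReducedWord`. -/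
def NoCancel (x y : ℤˣ × G) : Prop := x.2 ∈ toSubgroup A B x.1 → x.1 = y.1

variable (A B) in
/-- A word in an HNN extension is cyclically reduced if no two consecutive syllables cancel, the
first one being regarded as the successor of the last one. -/
def IsCyclicallyReducedWord (l : List (ℤˣ × G)) : Prop :=
  l.IsChain (NoCancel A B) ∧ ∀ᵉ (x ∈ l.getLast?) (y ∈ l.head?), NoCancel A B x y

theorem IsCyclicallyReducedWord.isChain_flatten_replicate {l : List (ℤˣ × G)}
    (hl : IsCyclicallyReducedWord A B l) (k : ℕ) :
    (List.replicate k l).flatten.IsChain (NoCancel A B) := by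
  rcases eq_or_ne l [] with rfl | hne
  · simp
  rw [List.isChain_flatten fun h => hne (List.eq_of_mem_replicate h).symm]
  exact ⟨fun l' h => List.eq_of_mem_replicate h ▸ hl.1, List.isChain_replicate_of_rel k hl.2⟩

variable (φ : A ≃* B)

/-- The element of an HNN extension represented by a word, a list of syllables `t ^ u * g`. -/
def syllableProd (l : List (ℤˣ × G)) : HNNExtension G A B φ :=
  (l.map fun x => t ^ (x.1 : ℤ) * of x.2).prod

@[simp]
theorem syllableProd_nil : syllableProd φ [] = 1 := rfl

@[simp]
theorem syllableProd_cons (x : ℤˣ × G) (l : List (ℤˣ × G)) :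
    syllableProd φ (x :: l) = t ^ (x.1 : ℤ) * of x.2 * syllableProd φ l :=
  List.prod_cons

@[simp]
theorem syllableProd_append (l l' : List (ℤˣ × G)) :
    syllableProd φ (l ++ l') = syllableProd φ l * syllableProd φ l' := by
  simp [syllableProd]

theorem syllableProd_flatten_replicate (l : List (ℤˣ × G)) (k : ℕ) :
    syllableProd φ (List.replicate k l).flatten = syllableProd φ l ^ k := by
  induction k with
  | zero => simp
  | succ k ih => simp [List.replicate_succ, ih, pow_succ']

theorem exists_conj_zpow_t_eq_of {u : ℤˣ} {g : G} (hg : g ∈ toSubgroup A B u) :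
    ∃ z : G, t ^ (u : ℤ) * of g * t ^ ((-u : ℤˣ) : ℤ) = (of z : HNNExtension G A B φ) := by
  rcases Int.units_eq_one_or u with rfl | rfl
  · exact ⟨φ ⟨g, hg⟩, by simp [equiv_eq_conj]⟩
  · exact ⟨φ.symm ⟨g, hg⟩, by simp [equiv_symm_eq_conj]⟩

theorem exists_mul_eq_of_not_noCancel {x y : ℤˣ × G} (h : ¬ NoCancel A B x y) :
    ∃ z : G, t ^ (x.1 : ℤ) * of x.2 * (t ^ (y.1 : ℤ) * of y.2) =
      (of z : HNNExtension G A B φ) := by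
  simp only [NoCancel, not_forall] at h
  obtain ⟨hmem, hne⟩ := h
  obtain ⟨z, hz⟩ := exists_conj_zpow_t_eq_of φ hmem
  have hy : y.1 = -x.1 := by
    rw [← Int.units_ne_iff_eq_neg]
    exact Ne.symm hne
  exact ⟨z * y.2, by rw [map_mul, ← hz, hy]; simp only [mul_assoc]⟩

theorem exists_length_lt_of_not_isChain {l : List (ℤˣ × G)} (hl : ¬ l.IsChain (NoCancel A B)) :
    ∃ (h : G) (l' : List (ℤˣ × G)), l'.length < l.length ∧
      of h * syllableProd φ l' = syllableProd φ l := by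
  induction l with
  | nil => simp at hl
  | cons x l ih =>
    by_cases hchain : l.IsChain (NoCancel A B)
    · rcases l with _ | ⟨y, l⟩
      · simp at hl
      have hxy : ¬ NoCancel A B x y := fun h => hl (List.isChain_cons_cons.2 ⟨h, hchain⟩)
      obtain ⟨z, hz⟩ := exists_mul_eq_of_not_noCancel φ hxy
      exact ⟨z, l, by simp, by rw [← hz]; simp [mul_assoc]⟩
    · obtain ⟨h, l', hlt, hprod⟩ := ih hchain
      exact ⟨1, (x.1, x.2 * h) :: l', by simpa using hlt, by simp [← hprod, mul_assoc]⟩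

theorem exists_length_eq_syllableProd_mul_of (l : List (ℤˣ × G)) (g : G) :
    ∃ (h : G) (l' : List (ℤˣ × G)), l'.length = l.length ∧
      of h * syllableProd φ l' = syllableProd φ l * of g := by
  rcases l.eq_nil_or_concat' with rfl | ⟨l, x, rfl⟩
  · exact ⟨g, [], by simp⟩
  · exact ⟨1, l ++ [(x.1, x.2 * g)], by simp, by simp [mul_assoc]⟩

theorem exists_of_mul_syllableProd_eq (g : HNNExtension G A B φ) :
    ∃ (h : G) (l : List (ℤˣ × G)), of h * syllableProd φ l = g := by
  obtain ⟨d⟩ := NormalWord.TransversalPair.nonempty G A B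
  obtain ⟨w, hw⟩ := (NormalWord.equiv (φ := φ) (d := d)).symm.surjective g
  exact ⟨w.head, w.toList, hw⟩

variable {φ}

/-- The syllable length of an element of an HNN extension: the least number of syllables
`t ^ (±1) * g` in a word representing it. It is attained by the reduced words. -/
noncomputable def syllableLength (g : HNNExtension G A B φ) : ℕ :=
  sInf {k | ∃ (h : G) (l : List (ℤˣ × G)), of h * syllableProd φ l = g ∧ l.length = k}

theorem syllableLength_le (h : G) (l : List (ℤˣ × G)) :
    syllableLength (of h * syllableProd φ l) ≤ l.length :=
  Nat.sInf_le ⟨h, l, rfl, rfl⟩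

theorem exists_reduced_length_eq (g : HNNExtension G A B φ) :
    ∃ (h : G) (l : List (ℤˣ × G)), of h * syllableProd φ l = g ∧
      l.length = syllableLength g ∧ l.IsChain (NoCancel A B) := by
  obtain ⟨h₀, l₀, hg⟩ := exists_of_mul_syllableProd_eq φ g
  obtain ⟨h, l, rfl, hlen : l.length = syllableLength _⟩ :=
    Nat.sInf_mem (⟨_, h₀, l₀, hg, rfl⟩ : Set.Nonempty
      {k | ∃ (h : G) (l : List (ℤˣ × G)), of h * syllableProd φ l = g ∧ l.length = k})
  refine ⟨h, l, rfl, hlen, ?_⟩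
  by_contra hl
  obtain ⟨h', l', hlt, hprod⟩ := exists_length_lt_of_not_isChain φ hl
  have hle := syllableLength_le (φ := φ) (h * h') l'
  rw [map_mul, mul_assoc, hprod, ← hlen] at hle
  exact hle.not_gt hlt

theorem syllableLength_eq_of_isChain (h : G) {l : List (ℤˣ × G)}
    (hl : l.IsChain (NoCancel A B)) : syllableLength (of h * syllableProd φ l) = l.length := by
  obtain ⟨h', l', hprod, hlen, hl'⟩ := exists_reduced_length_eq (of h * syllableProd φ l)
  have := (ReducedWord.map_fst_eq_and_of_prod_eq φ
    (w₁ := ⟨h', l', hl'⟩) (w₂ := ⟨h, l, hl⟩) hprod).1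
  rw [← hlen, ← List.length_map Prod.fst, this, List.length_map]

theorem syllableLength_mul_le (x y : HNNExtension G A B φ) :
    syllableLength (x * y) ≤ syllableLength x + syllableLength y := by
  obtain ⟨h, l, rfl, hl, -⟩ := exists_reduced_length_eq x
  obtain ⟨k, r, rfl, hr, -⟩ := exists_reduced_length_eq y
  obtain ⟨k', l', hl', hprod⟩ := exists_length_eq_syllableProd_mul_of φ l k
  have hxy : of h * syllableProd φ l * (of k * syllableProd φ r) =
      of (h * k') * syllableProd φ (l' ++ r) := by
    rw [map_mul, syllableProd_append, mul_assoc (of h), ← mul_assoc (syllableProd φ l), ← hprod]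
    simp only [mul_assoc]
  calc _ ≤ (l' ++ r).length := hxy ▸ syllableLength_le _ _
    _ = _ := by rw [List.length_append, hl', hl, hr]

theorem IsCyclicallyReducedWord.syllableLength_pow {l : List (ℤˣ × G)}
    (hl : IsCyclicallyReducedWord A B l) (k : ℕ) :
    syllableLength (syllableProd φ l ^ k) = k * l.length := by
  simpa [syllableProd_flatten_replicate] using
    syllableLength_eq_of_isChain (φ := φ) 1 (hl.isChain_flatten_replicate k)

theorem exists_isConj_syllableLength_le_of_not_noCancel {x y : ℤˣ × G} (l : List (ℤˣ × G))
    (h : ¬ NoCancel A B x y) :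
    ∃ g, IsConj (syllableProd φ (y :: l ++ [x])) g ∧ syllableLength g ≤ l.length := by
  obtain ⟨z, hz⟩ := exists_mul_eq_of_not_noCancel φ h
  refine ⟨of z * syllableProd φ l, isConj_iff.2 ⟨t ^ (x.1 : ℤ) * of x.2, ?_⟩,
    syllableLength_le z l⟩
  rw [← hz]
  simp [mul_assoc]

/-- The cyclically reduced word is found as one of minimal length in the conjugacy class. -/
theorem exists_isConj_of_or_isCyclicallyReducedWord (g : HNNExtension G A B φ) :
    (∃ x : G, IsConj g (of x)) ∨
      ∃ l ≠ [], IsCyclicallyReducedWord A B l ∧ IsConj g (syllableProd φ l) := by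
  obtain ⟨w, hgw, hmin⟩ :=
    exists_minimalFor_of_wellFoundedLT (IsConj g) syllableLength ⟨g, IsConj.refl g⟩
  obtain ⟨h, l, rfl, hlen, hl⟩ := exists_reduced_length_eq w
  rcases l.eq_nil_or_concat' with rfl | ⟨l, x, rfl⟩
  · exact Or.inl ⟨h, by simpa using hgw⟩
  set x' : ℤˣ × G := (x.1, x.2 * h)
  have hl' : (l ++ [x']).IsChain (NoCancel A B) := by
    simpa [List.isChain_append, NoCancel, x'] using hl
  have hconj : IsConj g (syllableProd φ (l ++ [x'])) :=
    hgw.trans (isConj_iff.2 ⟨(of h)⁻¹, by simp [x', mul_assoc]⟩)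
  refine Or.inr ⟨l ++ [x'], by simp, ⟨hl', fun x₁ hx₁ y hy => ?_⟩, hconj⟩
  obtain rfl : x' = x₁ := by simpa using hx₁
  rcases l with _ | ⟨y₀, l⟩
  · obtain rfl : x' = y := by simpa using hy
    exact fun _ => rfl
  obtain rfl : y₀ = y := by simpa using hy
  by_contra hcancel
  obtain ⟨g', hg', hle⟩ := exists_isConj_syllableLength_le_of_not_noCancel (φ := φ) l hcancel
  have hge := hmin (hconj.trans hg') (hle.trans (by grind))
  rw [← hlen, List.length_append, List.length_cons, List.length_singleton] at hge
  omega

theorem IsCyclicallyReducedWord.le_of_semiconjBy_pow {l : List (ℤˣ × G)} (hne : l ≠ [])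
    (hl : IsCyclicallyReducedWord A B l) {c : HNNExtension G A B φ} {M N : ℕ}
    (h : SemiconjBy c (syllableProd φ l ^ M) (syllableProd φ l ^ N)) : N ≤ M := by
  have hlen : syllableLength (syllableProd φ l) = l.length := by
    simpa using hl.syllableLength_pow (φ := φ) 1
  refine le_of_semiconjBy_pow_of_subadditive syllableLength_mul_le (fun k => ?_) ?_ h
  · rw [hl.syllableLength_pow, hlen]
  · rw [hlen]
    exact List.length_pos_iff.2 hne

theorem exists_isConj_of_of_semiconjBy_pow {g c : HNNExtension G A B φ} {M N : ℕ} (hMN : M ≠ N)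
    (h : SemiconjBy c (g ^ M) (g ^ N)) : ∃ x : G, IsConj g (of x) := by
  refine (exists_isConj_of_or_isCyclicallyReducedWord g).resolve_right ?_
  rintro ⟨l, hne, hl, hgl⟩
  obtain ⟨d, hd⟩ := isConj_iff.1 hgl
  have hconj : SemiconjBy (d * c * d⁻¹) (syllableProd φ l ^ M) (syllableProd φ l ^ N) := by
    rw [← hd, conj_pow, conj_pow]
    exact SemiconjBy.conj_iff.2 h
  exact hMN (le_antisymm (hl.le_of_semiconjBy_pow hne hconj.inv_symm_left)
    (hl.le_of_semiconjBy_pow hne hconj))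

theorem exists_isConj_of_of_semiconjBy_zpow {g c : HNNExtension G A B φ} {p q : ℤ}
    (hpq : |p| ≠ |q|) (h : SemiconjBy c (g ^ p) (g ^ q)) : ∃ x : G, IsConj g (of x) := by
  -- Conjugating by `c * c` instead of `c` makes both exponents nonnegative.
  have hsq : SemiconjBy (c * c) (g ^ (p ^ 2)) (g ^ (q ^ 2)) := by
    have hp := h.zpow_right p
    have hq := h.zpow_right q
    rw [← zpow_mul, ← zpow_mul] at hp hq
    rw [mul_comm p q] at hq
    rw [sq, sq]
    exact hq.mul_left hp
  rw [← Int.natAbs_sq p, ← Int.natAbs_sq q] at hsq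
  refine exists_isConj_of_of_semiconjBy_pow (c := c * c) (M := p.natAbs ^ 2) (N := q.natAbs ^ 2)
    ?_ (mod_cast hsq)
  exact fun he => hpq (by
    rw [Int.abs_eq_natAbs, Int.abs_eq_natAbs, Nat.pow_left_injective two_ne_zero he])

end HNN

/-- The isomorphism `f x ↦ g x` between the ranges of two injective homomorphisms. -/
noncomputable def rangeEquivRange {H G : Type*} [Group H] [Group G] {f g : H →* G}
    (hf : Function.Injective f) (hg : Function.Injective g) : f.range ≃* g.range :=
  (MonoidHom.ofInjective hf).symm.trans (MonoidHom.ofInjective hg)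

theorem rangeEquivRange_apply {H G : Type*} [Group H] [Group G] {f g : H →* G}
    (hf : Function.Injective f) (hg : Function.Injective g) (x : H) :
    rangeEquivRange hf hg ⟨f x, x, rfl⟩ = ⟨g x, x, rfl⟩ :=
  congrArg (MonoidHom.ofInjective hg) ((MonoidHom.ofInjective hf).symm_apply_apply x)

theorem reidemeisterNumber_eq_top_of_comp_eq {G H : Type*} [Group G] [CommGroup H] [Infinite H]
    {f : G →* H} (hf : Function.Surjective f) {φ : G →* G} (h : f.comp φ = f) :
    reidemeisterNumber φ = ⊤ := by
  rw [reidemeisterNumber, ENat.card_eq_top]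
  have hconst (x y : G) (hxy : (twistedConjSetoid φ).r x y) : f x = f y := by
    obtain ⟨g, rfl⟩ := hxy
    have hg : f (φ g) = f g := DFunLike.congr_fun h g
    rw [map_mul, map_mul, map_inv, hg, mul_inv_cancel_comm]
  exact Infinite.of_surjective (Quot.lift f hconst) ((Quot.surjective_lift hconst).2 hf)

namespace BaumslagSolitar

variable {m n : ℤ}

/-- The stable letter `a` of `B(m,n)`. -/
def genA (m n : ℤ) : BaumslagSolitar m n := PresentedGroup.of BSGen.a

/-- The base letter `b` of `B(m,n)`. -/
def genB (m n : ℤ) : BaumslagSolitar m n := PresentedGroup.of BSGen.b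

theorem semiconjBy_genA (m n : ℤ) : SemiconjBy (genA m n) (genB m n ^ n) (genB m n ^ m) := by
  have h : (genA m n)⁻¹ * genB m n ^ m * genA m n * (genB m n ^ n)⁻¹ = 1 :=
    PresentedGroup.one_of_mem (Set.mem_singleton (bsRelator m n))
  rw [SemiconjBy, ← mul_inv_eq_one.1 h]
  group

@[ext]
theorem hom_ext {G : Type*} [Group G] {f g : BaumslagSolitar m n →* G}
    (ha : f (genA m n) = g (genA m n)) (hb : f (genB m n) = g (genB m n)) : f = g :=
  PresentedGroup.ext fun x => by
    cases x
    exacts [ha, hb]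

section Lift

variable {G : Type*} [Group G] {x y : G} (h : SemiconjBy x (y ^ n) (y ^ m))

/-- The universal property of `B(m,n)`: the homomorphism with `a ↦ x` and `b ↦ y`. -/
def lift : BaumslagSolitar m n →* G :=
  PresentedGroup.toGroup (f := fun | .a => x | .b => y) fun r hr => by
    rw [Set.mem_singleton_iff.1 hr]
    simp [bsRelator, mul_assoc x⁻¹, ← h.eq]

@[simp]
theorem lift_genA : lift h (genA m n) = x := PresentedGroup.toGroup.of _

@[simp]
theorem lift_genB : lift h (genB m n) = y := PresentedGroup.toGroup.of _

end Lift

@[simp]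
theorem bsExpSum_genA : bsExpSum m n (genA m n) = Multiplicative.ofAdd 1 :=
  PresentedGroup.toGroup.of _

@[simp]
theorem bsExpSum_genB : bsExpSum m n (genB m n) = 1 :=
  PresentedGroup.toGroup.of _

theorem bsExpSum_surjective : Function.Surjective (bsExpSum m n) := fun k =>
  ⟨genA m n ^ k.toAdd, by rw [map_zpow, bsExpSum_genA, ← ofAdd_zsmul]; simp⟩

theorem bsExpSum_eq_of_isConj {x y : BaumslagSolitar m n} (h : IsConj x y) :
    bsExpSum m n x = bsExpSum m n y :=
  isConj_iff_eq.1 ((bsExpSum m n).map_isConj h)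

section HNN

theorem zpowGroupHom_int_injective (hm : m ≠ 0) :
    Function.Injective (zpowGroupHom m : Multiplicative ℤ →* Multiplicative ℤ) :=
  zpow_left_injective hm

/-- The HNN extension of `ℤ` whose stable letter conjugates `nℤ` to `mℤ` by `n * k ↦ m * k`. -/
abbrev HNN (hm : m ≠ 0) (hn : n ≠ 0) : Type :=
  HNNExtension (Multiplicative ℤ) _ _
    (rangeEquivRange (zpowGroupHom_int_injective hn) (zpowGroupHom_int_injective hm))

theorem semiconjBy_hnn_t (hm : m ≠ 0) (hn : n ≠ 0) :
    SemiconjBy (HNNExtension.t : HNN hm hn)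
      (HNNExtension.of (Multiplicative.ofAdd (1 : ℤ)) ^ n)
      (HNNExtension.of (Multiplicative.ofAdd (1 : ℤ)) ^ m) := by
  have h := HNNExtension.t_mul_of
    (φ := rangeEquivRange (zpowGroupHom_int_injective hn) (zpowGroupHom_int_injective hm))
    ⟨zpowGroupHom n (Multiplicative.ofAdd 1), _, rfl⟩
  rw [rangeEquivRange_apply] at h
  simpa only [SemiconjBy, zpowGroupHom_apply, map_zpow] using h

theorem genA_mul_zpowersHom_genB (hm : m ≠ 0) (hn : n ≠ 0)
    (x : (zpowGroupHom n : Multiplicative ℤ →* Multiplicative ℤ).range) :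
    genA m n * zpowersHom _ (genB m n) x = zpowersHom _ (genB m n)
      (rangeEquivRange (zpowGroupHom_int_injective hn) (zpowGroupHom_int_injective hm) x) *
        genA m n := by
  obtain ⟨_, k, rfl⟩ := x
  rw [rangeEquivRange_apply]
  simpa [zpow_mul] using ((semiconjBy_genA m n).zpow_right k.toAdd).eq

/-- `B(m,n)` is an HNN extension of the infinite cyclic group generated by `b`. -/
noncomputable def equivHNN (hm : m ≠ 0) (hn : n ≠ 0) : BaumslagSolitar m n ≃* HNN hm hn :=
  MonoidHom.toMulEquiv (lift (semiconjBy_hnn_t hm hn))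
    (HNNExtension.lift (zpowersHom _ (genB m n)) (genA m n) (genA_mul_zpowersHom_genB hm hn))
    (by ext <;> simp)
    (by ext <;> simp)

theorem equivHNN_symm_of (hm : m ≠ 0) (hn : n ≠ 0) (x : Multiplicative ℤ) :
    (equivHNN hm hn).symm (HNNExtension.of x) = genB m n ^ x.toAdd := by
  simp [equivHNN]

end HNN

theorem exists_isConj_genB_zpow (hm : m ≠ 0) (hn : n ≠ 0) {x c : BaumslagSolitar m n} {p q : ℤ}
    (hpq : |p| ≠ |q|) (h : SemiconjBy c (x ^ p) (x ^ q)) : ∃ k : ℤ, IsConj x (genB m n ^ k) := by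
  have hmap := h.map (equivHNN hm hn)
  rw [map_zpow, map_zpow] at hmap
  obtain ⟨y, hy⟩ := exists_isConj_of_of_semiconjBy_zpow hpq hmap
  refine ⟨y.toAdd, ?_⟩
  simpa only [MulEquiv.toMonoidHom_eq_coe, MonoidHom.coe_coe, MulEquiv.symm_apply_apply,
    equivHNN_symm_of] using (equivHNN hm hn).symm.toMonoidHom.map_isConj hy

section Affine

/-- The scaling factor `m / n` of `a` in the affine action of `B(m,n)` on `ℚ`. -/
def scale (hm : m ≠ 0) (hn : n ≠ 0) : ℚˣ := Units.mk0 (m / n) (by positivity)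

theorem semiconjBy_homothety (hm : m ≠ 0) (hn : n ≠ 0) :
    SemiconjBy (AffineEquiv.homothetyUnitsMulHom (0 : ℚ) (scale hm hn))
      (AffineEquiv.constVAddHom ℚ ℚ (Multiplicative.ofAdd 1) ^ n)
      (AffineEquiv.constVAddHom ℚ ℚ (Multiplicative.ofAdd 1) ^ m) := by
  rw [SemiconjBy, ← map_zpow (AffineEquiv.constVAddHom ℚ ℚ),
    ← map_zpow (AffineEquiv.constVAddHom ℚ ℚ), ← ofAdd_zsmul, ← ofAdd_zsmul]
  ext y
  have : (n : ℚ) ≠ 0 := mod_cast hn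
  simp only [scale, zsmul_eq_mul, mul_one, AffineEquiv.constVAddHom_apply, toAdd_ofAdd,
    AffineEquiv.coe_mul, AffineEquiv.coe_homothetyUnitsMulHom_apply, Units.val_mk0,
    Function.comp_apply, AffineEquiv.constVAdd_apply, vadd_eq_add, AffineMap.homothety_apply,
    vsub_eq_sub, sub_zero, smul_eq_mul, add_zero]
  field_simp

/-- The affine action of `B(m,n)` on `ℚ`: `b` translates by `1` and `a` scales by `m / n`. -/
noncomputable def affineRep (hm : m ≠ 0) (hn : n ≠ 0) : BaumslagSolitar m n →* (ℚ ≃ᵃ[ℚ] ℚ) :=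
  lift (semiconjBy_homothety hm hn)

theorem affineRep_genB_zpow (hm : m ≠ 0) (hn : n ≠ 0) (k : ℤ) (y : ℚ) :
    affineRep hm hn (genB m n ^ k) y = k + y := by
  rw [map_zpow, affineRep, lift_genB, ← map_zpow, ← ofAdd_zsmul]
  simp

theorem genB_ne_one (hm : m ≠ 0) (hn : n ≠ 0) : genB m n ≠ 1 := fun h => by
  simpa [h] using affineRep_genB_zpow hm hn 1 0

theorem linear_affineRep (hm : m ≠ 0) (hn : n ≠ 0) (g : BaumslagSolitar m n) (y : ℚ) :
    (affineRep hm hn g).linear y = (m / n : ℚ) ^ (bsExpSum m n g).toAdd * y := by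
  have h : AffineEquiv.linearHom.comp (affineRep hm hn) =
      (DistribMulAction.toModuleAut ℚ ℚ).comp
        ((zpowersHom ℚˣ (scale hm hn)).comp (bsExpSum m n)) := by
    ext z
    · simp only [affineRep, MonoidHom.comp_apply, lift_genA, bsExpSum_genA]
      change (AffineMap.homothety (0 : ℚ) (scale hm hn : ℚ)).linear z = _
      simp [Units.smul_def]
    · simp only [affineRep, MonoidHom.comp_apply, lift_genB, bsExpSum_genB, map_one]
      rfl
  calc (affineRep hm hn g).linear y
      = ((zpowersHom ℚˣ (scale hm hn) (bsExpSum m n g) : ℚˣ) : ℚ) * y :=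
        DFunLike.congr_fun (DFunLike.congr_fun h g) y
    _ = _ := by simp [scale]

theorem eq_zpow_bsExpSum_mul_of_semiconjBy (hm : m ≠ 0) (hn : n ≠ 0) {g : BaumslagSolitar m n}
    {p q : ℤ} (h : SemiconjBy g (genB m n ^ q) (genB m n ^ p)) :
    (p : ℚ) = (m / n : ℚ) ^ (bsExpSum m n g).toAdd * q := by
  have hact := DFunLike.congr_fun (h.map (affineRep hm hn)).eq (0 : ℚ)
  have haff := (affineRep hm hn g).map_vadd 0 (q : ℚ)
  rw [linear_affineRep, vadd_eq_add, vadd_eq_add, add_zero] at haff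
  rw [AffineEquiv.mul_def, AffineEquiv.mul_def, AffineEquiv.trans_apply, AffineEquiv.trans_apply,
    affineRep_genB_zpow, affineRep_genB_zpow, add_zero, haff] at hact
  exact (add_right_cancel hact).symm

end Affine

theorem bsExpSum_eq_of_semiconjBy_genB_zpow (hm : m ≠ 0) (hn : n ≠ 0) (hmn : |m| ≠ |n|)
    {c : BaumslagSolitar m n} {k : ℤ} (hk : k ≠ 0)
    (h : SemiconjBy c ((genB m n ^ k) ^ n) ((genB m n ^ k) ^ m)) :
    bsExpSum m n c = Multiplicative.ofAdd 1 := by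
  rw [← zpow_mul, ← zpow_mul] at h
  have hscale := eq_zpow_bsExpSum_mul_of_semiconjBy hm hn h
  push_cast at hscale
  have hpow : (m / n : ℚ) ^ (bsExpSum m n c).toAdd = (m / n : ℚ) ^ (1 : ℤ) := by
    rw [zpow_one, eq_div_iff (by exact_mod_cast hn)]
    refine mul_left_cancel₀ (Int.cast_ne_zero.2 hk : (k : ℚ) ≠ 0) ?_
    linear_combination -hscale
  have hpos : 0 < |(m / n : ℚ)| := by positivity
  have hne : |(m / n : ℚ)| ≠ 1 := by
    rw [abs_div, Ne, div_eq_one_iff_eq (by positivity)]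
    exact_mod_cast hmn
  have habs := congrArg abs hpow
  rw [abs_zpow, abs_zpow] at habs
  exact Multiplicative.toAdd.injective (zpow_right_injective₀ hpos hne habs)

theorem bsExpSum_comp_eq (hm : m ≠ 0) (hn : n ≠ 0) (hmn : |m| ≠ |n|)
    {φ : BaumslagSolitar m n →* BaumslagSolitar m n} (hφ : φ (genB m n) ≠ 1) :
    (bsExpSum m n).comp φ = bsExpSum m n := by
  have hrel := (semiconjBy_genA m n).map φ
  rw [map_zpow, map_zpow] at hrel
  obtain ⟨k, hk⟩ := exists_isConj_genB_zpow hm hn hmn.symm hrel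
  have hk0 : k ≠ 0 := by
    rintro rfl
    exact hφ (isConj_one_right.1 (by simpa using hk.symm))
  obtain ⟨d, hd⟩ := isConj_iff.1 hk
  have hconj : SemiconjBy (d * φ (genA m n) * d⁻¹)
      ((genB m n ^ k) ^ n) ((genB m n ^ k) ^ m) := by
    rw [← hd, conj_zpow, conj_zpow]
    exact SemiconjBy.conj_iff.2 hrel
  ext
  · rw [MonoidHom.comp_apply, bsExpSum_eq_of_isConj (isConj_iff.2 ⟨d, rfl⟩),
      bsExpSum_eq_of_semiconjBy_genB_zpow hm hn hmn hk0 hconj, bsExpSum_genA]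
  · rw [MonoidHom.comp_apply, bsExpSum_eq_of_isConj hk, map_zpow, bsExpSum_genB, one_zpow]

end BaumslagSolitar

open BaumslagSolitar in
theorem theorem4p4_general {m n : ℤ} (hm : m ≠ 0) (hn : n ≠ 0) (hmn : |m| ≠ |n|)
    (φ : BaumslagSolitar m n →* BaumslagSolitar m n) (hφ : φ (genB m n) ≠ 1) :
    (∀ g : BaumslagSolitar m n, bsExpSum m n (φ g) = bsExpSum m n g) ∧
      reidemeisterNumber φ = ⊤ :=
  have h := bsExpSum_comp_eq hm hn hmn hφ
  ⟨DFunLike.congr_fun h, reidemeisterNumber_eq_top_of_comp_eq bsExpSum_surjective h⟩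

theorem theorem4p4 (m n : ℤ) (hm : 1 < |m|) (hn : 1 < |n|) (hmn : |m| ≠ |n|)
    (φ : BaumslagSolitar m n →* BaumslagSolitar m n) (hφ : Function.Injective φ) :
    (∀ g : BaumslagSolitar m n, bsExpSum m n (φ g) = bsExpSum m n g) ∧
      reidemeisterNumber φ = ⊤ := by
  have hm0 : m ≠ 0 := abs_pos.1 (zero_lt_one.trans hm)
  have hn0 : n ≠ 0 := abs_pos.1 (zero_lt_one.trans hn)
  exact theorem4p4_general hm0 hn0 hmn φ
    ((map_ne_one_iff φ hφ).2 (BaumslagSolitar.genB_ne_one hm0 hn0))
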